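/- \textbf{Theorem (conditional Banach--Steinhaus).} Let $(\Omega,\mathcal F,\mu)$ be a $\sigma$-finite measure space. For $E\in\{\mathbb N,\mathbb Q,\mathbb R\}$ let $L^0(E)$ be the set of measurable functions $\Omega\to E$ modulo almost everywhere equality; equalities and inequalities between such functions are understood almost everywhere, and $L^0_{++}(\mathbb Q)=\{r\in L^0(\mathbb Q): r>0\text{ a.e.}\}$. An \emph{$L^0(\mathbb R)$-normed module} is a module $H$ over the ring $L^0(\mathbb R)$ such that (i) for every sequence $(x_k)$ in $H$ and every countable measurable partition $(A_k)$ of $\Omega$ there is a unique $x\in H$ with $1_{A_k}x=1_{A_k}x_k$ for all $k$, denoted $\sum_k x_k|A_k$; (ii) $H$ carries a map $\|\cdot\|\colon H\to L^0(\mathbb R)$ with $\|x\|\ge 0$; $\|x\|=0$ if and only if $x=0$; $\|rx\|=|r|\,\|x\|$; and $\|x+y\|\le\|x\|+\|y\|$, for all $x,y\in H$ and $r\in L^0(\mathbb R)$. For a sequence $(x_k)_{k\in\mathbb N}$ in $H$ and $n\in L^0(\mathbb N)$ put $x_n:=\sum_k x_k|\{n=k\}$. The module $H$ is \emph{conditionally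 separable} if there is a countable set $G\subseteq H$ such that for every $x\in H$ there are a sequence $(x_k)$ in $G$ and $n_1<n_2<\cdots$ in $L^0(\mathbb N)$ with $\|x_{n_m}-x\|\to 0$ a.e. as $m\to\infty$. It is \emph{conditionally complete} if for every sequence $(x_k)$ in $H$ such that for all $r\in L^0_{++}(\mathbb Q)$ there is $n\in L^0(\mathbb N)$ with $\|x_m-x_p\|<r$ for all $m,p\in L^0(\mathbb N)$ with $m,p\ge n$, there is $x\in H$ with $\|x_k-x\|\to0$ a.e. Let $H$ and $K$ be conditionally separable and conditionally complete $L^0(\mathbb R)$-normed modules, and let $(f_n)_{n\in\mathbb N}$ be a sequence of $L^0(\mathbb R)$-linear maps $f_n\colon H\to K$, each of which is sequentially continuous, that is, $\|f_n(x_k)-f_n(x)\|\to0$ a.e. whenever $\|x_k-x\|\to 0$ a.e. Suppose that for every $x\in H$ there is $r\in L^0_{++}(\mathbb Q)$ such that $\|f_n(x)\|\le r$ for all $n$. Then there is $q\in L^0_{++}(\mathbb Q)$ such that $\|f_n(x)\|\le q\,\|x\|$ for all $x\in H$ and all $n\in\mathbb N$. -/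

import Mathlib

open MeasureTheory Filter Topology

namespace CondAnalysis

/-- `L0 E μ` is `L⁰(E)`: measurable functions `Ω → E` modulo `μ`-a.e. equality (for the
second countable metrizable spaces `E = ℝ, ℚ, ℕ` used here, strongly measurable is the same as
Borel measurable). -/
abbrev L0 {Ω : Type*} [MeasurableSpace Ω] (E : Type*) [TopologicalSpace E] (μ : Measure Ω) :
    Type _ :=
  Ω →ₘ[μ] E

section

variable {Ω : Type*} [MeasurableSpace Ω] {μ : Measure Ω}

/-- The ring structure of `L⁰(ℝ)`, with the almost everywhere pointwise operations that Mathlib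
puts on `Ω →ₘ[μ] ℝ`. -/
noncomputable instance instCommRingL0 : CommRing (L0 ℝ μ) :=
  { (inferInstance : AddCommGroup (Ω →ₘ[μ] ℝ)), (inferInstance : CommMonoid (Ω →ₘ[μ] ℝ)) with
    left_distrib := fun a b c => AEEqFun.toGerm_injective <| by
      simp only [AEEqFun.mul_toGerm, AEEqFun.add_toGerm, mul_add]
    right_distrib := fun a b c => AEEqFun.toGerm_injective <| by
      simp only [AEEqFun.mul_toGerm, AEEqFun.add_toGerm, add_mul]
    zero_mul := fun a => AEEqFun.toGerm_injective <| by
      simp only [AEEqFun.mul_toGerm, AEEqFun.zero_toGerm, zero_mul]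
    mul_zero := fun a => AEEqFun.toGerm_injective <| by
      simp only [AEEqFun.mul_toGerm, AEEqFun.zero_toGerm, mul_zero] }

/-- Strict inequality almost everywhere. (The relation `<` that comes with the partial order of
`L⁰` only says `≤` and `≠`.) -/
def AELt {E : Type*} [TopologicalSpace E] [LT E] (x y : L0 E μ) : Prop :=
  ∀ᵐ ω ∂μ, x ω < y ω

/-- The inclusion of `L⁰(ℚ)` into `L⁰(ℝ)`. -/
noncomputable def ratToReal (r : L0 ℚ μ) : L0 ℝ μ :=
  AEEqFun.comp (fun q : ℚ => (q : ℝ)) Rat.continuous_coe_real r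

variable (μ) in
/-- `L⁰₊₊(ℚ)`, regarded as a subset of `L⁰(ℝ)`. -/
def L0PosRat : Set (L0 ℝ μ) :=
  {x | ∃ r : L0 ℚ μ, AELt 0 r ∧ x = ratToReal r}

/-- Almost everywhere convergence to `0` of a sequence in `L⁰(ℝ)`. -/
def AETendstoZero (u : ℕ → L0 ℝ μ) : Prop :=
  ∀ᵐ ω ∂μ, Tendsto (fun k => u k ω) atTop (𝓝 0)

variable (μ) in
/-- The class in `L⁰(ℝ)` of the indicator function of a measurable set. -/
noncomputable def ind (A : Set Ω) (hA : MeasurableSet A) : L0 ℝ μ :=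
  AEEqFun.mk (A.indicator fun _ => (1 : ℝ))
    (stronglyMeasurable_const.indicator hA).aestronglyMeasurable

end

/-- A countable measurable partition of `Ω`; some of its members may be empty, so that finite
partitions are included. -/
structure MeasurablePartition (Ω : Type*) [MeasurableSpace Ω] where
  set : ℕ → Set Ω
  measurableSet : ∀ k, MeasurableSet (set k)
  disjoint : Pairwise fun i j => Disjoint (set i) (set j)
  iUnion_eq : ⋃ k, set k = Set.univ

/-- The partition `({n = k})_k` given by `n ∈ L⁰(ℕ)`. -/
def levelPartition {Ω : Type*} [MeasurableSpace Ω] {μ : Measure Ω} (n : L0 ℕ μ) :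
    MeasurablePartition Ω where
  set k := {ω | n ω = k}
  measurableSet k := n.stronglyMeasurable.measurable (measurableSet_singleton k)
  disjoint _ _ hij := Set.disjoint_left.2 fun _ hi hj => hij (hi.symm.trans hj)
  iUnion_eq := Set.eq_univ_of_forall fun ω => Set.mem_iUnion.2 ⟨n ω, rfl⟩

/-- `z` is a concatenation of the sequence `x` along the partition `A`: `1_{A k} z = 1_{A k} x_k`
for all `k`. -/
def IsConcat {Ω : Type*} [MeasurableSpace Ω] (μ : Measure Ω) {H : Type*} [AddCommGroup H]
    [Module (L0 ℝ μ) H] (A : MeasurablePartition Ω) (x : ℕ → H) (z : H) : Prop :=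
  ∀ k, ind μ (A.set k) (A.measurableSet k) • z = ind μ (A.set k) (A.measurableSet k) • x k

/-- An `L⁰(ℝ)`-normed module: an `L⁰(ℝ)`-module with the countable concatenation property and with
a conditional norm, whose values lie in `L⁰₊(ℝ)`. -/
class NormedL0Module {Ω : Type*} [MeasurableSpace Ω] (μ : Measure Ω) (H : Type*) [AddCommGroup H]
    [Module (L0 ℝ μ) H] where
  existsUnique_concat : ∀ (A : MeasurablePartition Ω) (x : ℕ → H), ∃! z, IsConcat μ A x z
  cnorm : H → L0 ℝ μ
  cnorm_nonneg : ∀ x, 0 ≤ cnorm x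
  cnorm_eq_zero_iff : ∀ x, cnorm x = 0 ↔ x = 0
  cnorm_smul : ∀ (r : L0 ℝ μ) (x : H), cnorm (r • x) = |r| * cnorm x
  cnorm_add_le : ∀ x y, cnorm (x + y) ≤ cnorm x + cnorm y

section

variable {Ω : Type*} [MeasurableSpace Ω] (μ : Measure Ω)
variable {H : Type*} [AddCommGroup H] [Module (L0 ℝ μ) H] [NormedL0Module μ H]

/-- The conditional norm. -/
def cnorm (x : H) : L0 ℝ μ := NormedL0Module.cnorm x

/-- The concatenation `∑ₖ xₖ|Aₖ`. -/
noncomputable def concat (A : MeasurablePartition Ω) (x : ℕ → H) : H :=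
  (NormedL0Module.existsUnique_concat (μ := μ) A x).choose

variable {μ} in
/-- The element `x_n = ∑ₖ xₖ|{n = k}` of a sequence at an index `n ∈ L⁰(ℕ)`. -/
noncomputable def seqAt (x : ℕ → H) (n : L0 ℕ μ) : H :=
  concat μ (levelPartition n) x

/-- `d(xₖ, y) → 0` almost everywhere, for the conditional metric `d(x, y) = ‖x - y‖`. -/
def CTendsto (x : ℕ → H) (y : H) : Prop :=
  AETendstoZero fun k => cnorm μ (x k - y)

/-- Conditional Cauchy sequences: for all `r ∈ L⁰₊₊(ℚ)` there is `n ∈ L⁰(ℕ)` such that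
`d(x_m, x_p) < r` for all `m, p ∈ L⁰(ℕ)` with `m, p ≥ n`. A sequence indexed by `L⁰(ℕ)` that
commutes with concatenations is the same as a sequence indexed by `ℕ`, extended by `seqAt`. -/
def IsCondCauchy (x : ℕ → H) : Prop :=
  ∀ r ∈ L0PosRat μ, ∃ n : L0 ℕ μ, ∀ m p : L0 ℕ μ, n ≤ m → n ≤ p →
    AELt (cnorm μ (seqAt x m - seqAt x p)) r

variable (H)

/-- There is a countable `G ⊆ H` such that every `x ∈ H` is the a.e. limit of `x_{n₁}, x_{n₂}, …`
for some sequence `(xₖ)` in `G` and some `n₁ < n₂ < …` in `L⁰(ℕ)`. -/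
def CondSeparable : Prop :=
  ∃ G : Set H, G.Countable ∧ ∀ x : H, ∃ y : ℕ → H, (∀ k, y k ∈ G) ∧
    ∃ n : ℕ → L0 ℕ μ, (∀ j, AELt (n j) (n (j + 1))) ∧ CTendsto μ (fun j => seqAt y (n j)) x

/-- Every conditional Cauchy sequence converges almost everywhere. -/
def CondComplete : Prop :=
  ∀ x : ℕ → H, IsCondCauchy μ x → ∃ y : H, CTendsto μ x y

variable {H}

/-- Sequential continuity with respect to almost everywhere convergence. -/
def SeqContinuousAE {K : Type*} [AddCommGroup K] [Module (L0 ℝ μ) K] [NormedL0Module μ K]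
    (f : H → K) : Prop :=
  ∀ (x : ℕ → H) (y : H), CTendsto μ x y → CTendsto μ (fun k => f (x k)) (f y)

end

end CondAnalysis

namespace CondAnalysis

/-! ### Pointwise calculus for the conditional norm and concatenations -/

section Norm

variable {Ω : Type*} [MeasurableSpace Ω] {μ : Measure Ω}
variable {H : Type*} [AddCommGroup H] [Module (L0 ℝ μ) H] [NormedL0Module μ H]

/-! The proof is a gliding hump run at almost every `ω` at once, with no category argument.
Conditional separability reduces uniform boundedness to countably many inequalities, so the set `A`
of points where no constant works is measurable. On `A`, rescaling produces arbitrarily small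
elements that some `f n` sends to norm one (`bounded_or_exists_small`). For a constant sequence of
maps this contradicts continuity unless `A` is null, so each `f n` alone has a measurable bound `C
n` (`SeqContinuousAE.exists_bound`).

For the whole sequence, successive corrections build `x j` such that on `A` some `f n`, with `n`
depending on `ω`, has norm at least `j` at `x (j + 1)`. Later corrections are so small relative to
`C n` that the limit `y` still satisfies `‖f n y‖ ≥ j - 1`. Boundedness of the orbit of `y` then
forces `μ A = 0` (`measure_eq_zero_of_small`).

Every choice depending on `ω` is made among countably many candidates: `exists_measurable_index`
selects one measurably, and `exists_cnorm_map_ae_eq` glues the selected elements by concatenation.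
-/

lemma cnorm_ae_nonneg (x : H) : ∀ᵐ ω ∂μ, 0 ≤ cnorm μ x ω := by
  have h := AEEqFun.coeFn_le.2 (NormedL0Module.cnorm_nonneg (μ := μ) x)
  filter_upwards [h, AEEqFun.coeFn_zero (μ := μ) (β := ℝ)] with ω h1 h2
  rw [h2] at h1
  exact h1

lemma cnorm_add_ae_le (x y : H) :
    ∀ᵐ ω ∂μ, cnorm μ (x + y) ω ≤ cnorm μ x ω + cnorm μ y ω := by
  have h := AEEqFun.coeFn_le.2 (NormedL0Module.cnorm_add_le (μ := μ) x y)
  filter_upwards [h, AEEqFun.coeFn_add (cnorm μ x) (cnorm μ y)] with ω h1 h2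
  exact h1.trans_eq h2

lemma cnorm_smul_ae (r : L0 ℝ μ) (x : H) :
    ∀ᵐ ω ∂μ, cnorm μ (r • x) ω = |r ω| * cnorm μ x ω := by
  have h : cnorm μ (r • x) = |r| * cnorm μ x := NormedL0Module.cnorm_smul r x
  filter_upwards [AEEqFun.coeFn_mul |r| (cnorm μ x), AEEqFun.coeFn_abs r] with ω h1 h2
  rw [h, ← h2]
  exact h1

lemma cnorm_const_smul_ae (c : ℝ) (x : H) :
    ∀ᵐ ω ∂μ, cnorm μ ((AEEqFun.const Ω c : L0 ℝ μ) • x) ω = |c| * cnorm μ x ω := by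
  filter_upwards [cnorm_smul_ae (AEEqFun.const Ω c : L0 ℝ μ) x,
    AEEqFun.coeFn_const (μ := μ) (α := Ω) c] with ω h1 h2
  rw [h1, h2, Function.const_apply]

lemma cnorm_neg_ae (x : H) : ∀ᵐ ω ∂μ, cnorm μ (-x) ω = cnorm μ x ω := by
  have h := cnorm_smul_ae (μ := μ) (-1) x
  rw [neg_one_smul] at h
  filter_upwards [h, AEEqFun.coeFn_neg (1 : L0 ℝ μ), AEEqFun.coeFn_one (μ := μ) (β := ℝ)]
    with ω h1 h2 h3
  have h4 : (-1 : L0 ℝ μ) ω = -1 := h2.trans (by simp [h3])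
  rw [h1, h4]
  simp

lemma cnorm_sub_comm_ae (x y : H) :
    ∀ᵐ ω ∂μ, cnorm μ (x - y) ω = cnorm μ (y - x) ω := by
  have h := cnorm_neg_ae (μ := μ) (y - x)
  rwa [neg_sub] at h

lemma cnorm_sub_ae_le (x y z : H) :
    ∀ᵐ ω ∂μ, cnorm μ (x - z) ω ≤ cnorm μ (x - y) ω + cnorm μ (y - z) ω := by
  have h := cnorm_add_ae_le (μ := μ) (x - y) (y - z)
  rwa [sub_add_sub_cancel] at h

lemma abs_cnorm_sub_cnorm_ae_le (x y : H) :
    ∀ᵐ ω ∂μ, |cnorm μ x ω - cnorm μ y ω| ≤ cnorm μ (x - y) ω := by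
  have h := cnorm_add_ae_le (μ := μ) (x - y) y
  have h' := cnorm_add_ae_le (μ := μ) (y - x) x
  rw [sub_add_cancel] at h h'
  filter_upwards [h, h', cnorm_sub_comm_ae (μ := μ) x y] with ω h1 h2 h3
  rw [abs_le]
  constructor <;> linarith

/-- The conditional norm is local. -/
lemma cnorm_ae_eq_of_ind_smul_eq {A : Set Ω} (hA : MeasurableSet A) {x y : H}
    (h : ind μ A hA • x = ind μ A hA • y) : ∀ᵐ ω ∂μ, ω ∈ A → cnorm μ x ω = cnorm μ y ω := by
  have h1 := cnorm_smul_ae (ind μ A hA) x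
  rw [h] at h1
  filter_upwards [h1, cnorm_smul_ae (ind μ A hA) y, AEEqFun.coeFn_mk (A.indicator fun _ => (1 : ℝ))
    (stronglyMeasurable_const.indicator hA).aestronglyMeasurable (μ := μ)] with ω h1 h2 h3 hω
  have h4 : ind μ A hA ω = 1 := h3.trans (by simp [hω])
  rw [h2, h4] at h1
  simpa using h1.symm

lemma measurable_cnorm (x : H) : Measurable (cnorm μ x) :=
  (cnorm μ x).stronglyMeasurable.measurable

/-- The partition of `Ω` into the level sets of a measurable function. -/
def fiberPartition (τ : Ω → ℕ) (hτ : Measurable τ) : MeasurablePartition Ω where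
  set k := {ω | τ ω = k}
  measurableSet k := hτ (measurableSet_singleton k)
  disjoint _ _ hij := Set.disjoint_left.2 fun _ hi hj => hij (hi.symm.trans hj)
  iUnion_eq := Set.eq_univ_of_forall fun ω => Set.mem_iUnion.2 ⟨τ ω, rfl⟩

lemma isConcat_concat (A : MeasurablePartition Ω) (x : ℕ → H) :
    IsConcat μ A x (concat μ A x) :=
  (NormedL0Module.existsUnique_concat (μ := μ) A x).choose_spec.1

lemma IsConcat.cnorm_map_ae {H : Type*} [AddCommGroup H] [Module (L0 ℝ μ) H] {K : Type*}
    [AddCommGroup K] [Module (L0 ℝ μ) K] [NormedL0Module μ K] {A : MeasurablePartition Ω}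
    {x : ℕ → H} {z : H} (h : IsConcat μ A x z) (f : H →ₗ[L0 ℝ μ] K) :
    ∀ᵐ ω ∂μ, ∀ k, ω ∈ A.set k → cnorm μ (f z) ω = cnorm μ (f (x k)) ω := by
  refine ae_all_iff.2 fun k => cnorm_ae_eq_of_ind_smul_eq (A.measurableSet k) ?_
  rw [← map_smul, h k, map_smul]

lemma IsConcat.cnorm_sub_ae {A : MeasurablePartition Ω} {x : ℕ → H} {z : H}
    (h : IsConcat μ A x z) (w : H) :
    ∀ᵐ ω ∂μ, ∀ k, ω ∈ A.set k → cnorm μ (z - w) ω = cnorm μ (x k - w) ω := by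
  refine ae_all_iff.2 fun k => cnorm_ae_eq_of_ind_smul_eq (A.measurableSet k) ?_
  rw [smul_sub, smul_sub, h k]

variable {K : Type*} [AddCommGroup K] [Module (L0 ℝ μ) K] [NormedL0Module μ K]

lemma cnorm_map_seqAt_ae (f : H →ₗ[L0 ℝ μ] K) (x : ℕ → H) (n : L0 ℕ μ) :
    ∀ᵐ ω ∂μ, cnorm μ (f (seqAt x n)) ω = cnorm μ (f (x (n ω))) ω := by
  filter_upwards [(isConcat_concat (levelPartition n) x).cnorm_map_ae f] with ω h
  exact h (n ω) rfl

/-- Locality resolves one argument of the difference at a time; symmetry of the distance exchanges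
the arguments in between. -/
lemma cnorm_seqAt_sub_seqAt_ae (x : ℕ → H) (m p : L0 ℕ μ) :
    ∀ᵐ ω ∂μ, cnorm μ (seqAt x m - seqAt x p) ω = cnorm μ (x (m ω) - x (p ω)) ω := by
  filter_upwards [(isConcat_concat (levelPartition m) x).cnorm_sub_ae (seqAt x p),
    ae_all_iff.2 fun k => (isConcat_concat (levelPartition p) x).cnorm_sub_ae (x k),
    ae_all_iff.2 fun k => cnorm_sub_comm_ae (μ := μ) (x k) (seqAt x p),
    ae_all_iff.2 fun k => ae_all_iff.2 fun l => cnorm_sub_comm_ae (μ := μ) (x k) (x l)]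
    with ω h1 h2 h3 h4
  rw [seqAt, h1 (m ω) rfl, h3, seqAt, h2 _ (p ω) rfl, h4]

lemma exists_cnorm_map_ae_eq (x : ℕ → H) (τ : Ω → ℕ) (hτ : Measurable τ) :
    ∃ z : H, (∀ f : H →ₗ[L0 ℝ μ] K, ∀ᵐ ω ∂μ, cnorm μ (f z) ω = cnorm μ (f (x (τ ω))) ω) ∧
      ∀ w, ∀ᵐ ω ∂μ, cnorm μ (z - w) ω = cnorm μ (x (τ ω) - w) ω := by
  have hz := isConcat_concat (μ := μ) (fiberPartition τ hτ) x
  refine ⟨concat μ (fiberPartition τ hτ) x, fun f => ?_, fun w => ?_⟩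
  · filter_upwards [hz.cnorm_map_ae f] with ω h
    exact h _ rfl
  · filter_upwards [hz.cnorm_sub_ae w] with ω h
    exact h _ rfl

end Norm

lemma exists_measurable_index {Ω : Type*} [MeasurableSpace Ω] {μ : Measure Ω} {P : ℕ → Set Ω}
    (hP : ∀ i, MeasurableSet (P i)) (h : ∀ᵐ ω ∂μ, ∃ i, ω ∈ P i) :
    ∃ τ : Ω → ℕ, Measurable τ ∧ ∀ᵐ ω ∂μ, ω ∈ P (τ ω) := by
  classical
  -- The second alternative lets the search for a least index succeed at every `ω`, including the
  -- exceptional null set.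
  have hp : ∀ ω, ∃ i, ω ∈ P i ∨ ω ∉ ⋃ i, P i := fun ω => by
    by_cases hω : ω ∈ ⋃ i, P i
    · exact (Set.mem_iUnion.1 hω).imp fun i hi => Or.inl hi
    · exact ⟨0, Or.inr hω⟩
  refine ⟨fun ω => Nat.find (hp ω), measurable_find hp fun k =>
    (hP k).union (MeasurableSet.iUnion hP).compl, ?_⟩
  filter_upwards [h] with ω hω
  exact (Nat.find_spec (hp ω)).resolve_right fun h => h (Set.mem_iUnion.2 hω)

/-! ### The dichotomy, and bounds for a single map -/

section Boundedness

variable {Ω : Type*} [MeasurableSpace Ω] {μ : Measure Ω}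
variable {H : Type*} [AddCommGroup H] [Module (L0 ℝ μ) H] [NormedL0Module μ H]
variable {K : Type*} [AddCommGroup K] [Module (L0 ℝ μ) K] [NormedL0Module μ K]

lemma CTendsto.tendsto_cnorm {x : ℕ → H} {y : H} (h : CTendsto μ x y) :
    ∀ᵐ ω ∂μ, Tendsto (fun k => cnorm μ (x k) ω) atTop (𝓝 (cnorm μ y ω)) := by
  filter_upwards [h, ae_all_iff.2 fun k => abs_cnorm_sub_cnorm_ae_le (μ := μ) (x k) y] with ω h1 h2
  rw [tendsto_iff_dist_tendsto_zero]
  exact squeeze_zero (fun _ => dist_nonneg) h2 h1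

/-- A sequence of linear maps is uniformly bounded by `q` as soon as it is on a countable set that
is conditionally dense. -/
lemma ae_le_mul_cnorm_of_dense {G : Set H}
    (hG : ∀ x : H, ∃ y : ℕ → H, (∀ k, y k ∈ G) ∧
      ∃ n : ℕ → L0 ℕ μ, (∀ j, AELt (n j) (n (j + 1))) ∧ CTendsto μ (fun j => seqAt y (n j)) x)
    {f : H →ₗ[L0 ℝ μ] K} (hf : SeqContinuousAE μ f) {q : Ω → ℕ}
    (hq : ∀ᵐ ω ∂μ, ∀ g ∈ G, cnorm μ (f g) ω ≤ q ω * cnorm μ g ω) (x : H) :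
    ∀ᵐ ω ∂μ, cnorm μ (f x) ω ≤ q ω * cnorm μ x ω := by
  obtain ⟨y, hy, n, -, hn⟩ := hG x
  filter_upwards [hq, hn.tendsto_cnorm, (hf _ _ hn).tendsto_cnorm,
    ae_all_iff.2 fun j => cnorm_map_seqAt_ae f y (n j),
    ae_all_iff.2 fun j => cnorm_map_seqAt_ae (LinearMap.id : H →ₗ[L0 ℝ μ] H) y (n j)]
    with ω h1 h2 h3 h4 h5
  refine le_of_tendsto_of_tendsto' h3 (h2.const_mul (q ω : ℝ)) fun j => ?_
  have h6 := h5 j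
  simp only [LinearMap.id_apply] at h6
  rw [h4 j, h6]
  exact h1 _ (hy _)

/-- Either a sequence of sequentially continuous linear maps is uniformly bounded, or on a set of
positive measure it maps arbitrarily small members of a fixed sequence to elements of norm `1`. -/
lemma bounded_or_exists_small (hH : CondSeparable μ H) (f : ℕ → H →ₗ[L0 ℝ μ] K)
    (hf : ∀ n, SeqContinuousAE μ (f n)) :
    (∃ q : Ω → ℕ, Measurable q ∧ ∀ n x, ∀ᵐ ω ∂μ, cnorm μ (f n x) ω ≤ q ω * cnorm μ x ω) ∨
    ∃ A : Set Ω, MeasurableSet A ∧ μ A ≠ 0 ∧ ∃ u : ℕ → H,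
      ∀ᵐ ω ∂μ, ω ∈ A → ∀ ε > 0, ∃ l n, cnorm μ (u l) ω ≤ ε ∧ cnorm μ (f n (u l)) ω = 1 := by
  obtain ⟨G, hGc, hG⟩ := hH
  have hGne : G.Nonempty := by
    obtain ⟨y, hy, -⟩ := hG 0
    exact ⟨y 0, hy 0⟩
  obtain ⟨g, rfl⟩ := hGc.exists_eq_range hGne
  set P : ℕ → Set Ω := fun k => ⋂ n, ⋂ i, {ω | cnorm μ (f n (g i)) ω ≤ k * cnorm μ (g i) ω} with hPdef
  have hP : ∀ k, MeasurableSet (P k) := fun k =>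
    MeasurableSet.iInter fun n => MeasurableSet.iInter fun i =>
      measurableSet_le (measurable_cnorm _) ((measurable_cnorm _).const_mul _)
  have hmem : ∀ k ω, ω ∈ P k ↔ ∀ n i, cnorm μ (f n (g i)) ω ≤ k * cnorm μ (g i) ω := fun k ω => by
    simp [hPdef]
  by_cases hA : μ (⋃ k, P k)ᶜ = 0
  · left
    have h : ∀ᵐ ω ∂μ, ∃ k, ω ∈ P k := by
      filter_upwards [measure_eq_zero_iff_ae_notMem.1 hA] with ω hω
      simpa using hω
    obtain ⟨q, hqm, hq⟩ := exists_measurable_index hP h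
    refine ⟨q, hqm, fun n x => ae_le_mul_cnorm_of_dense hG (hf n) ?_ x⟩
    filter_upwards [hq] with ω hω
    rintro _ ⟨i, rfl⟩
    exact (hmem _ _).1 hω n i
  · right
    refine ⟨_, (MeasurableSet.iUnion hP).compl, hA, ?_⟩
    have hr : ∀ n i, Measurable fun ω => (cnorm μ (f n (g i)) ω)⁻¹ := fun n i =>
      (measurable_cnorm _).inv
    let r : ℕ → ℕ → L0 ℝ μ := fun n i => AEEqFun.mk _ (hr n i).aestronglyMeasurable
    have hr' : ∀ n i, ∀ᵐ ω ∂μ, r n i ω = (cnorm μ (f n (g i)) ω)⁻¹ := fun n i =>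
      AEEqFun.coeFn_mk _ _
    -- All `g i / ‖f n (g i)‖`, indexed by pairs `(n, i)`. Where the denominator vanishes the
    -- inverse is `0`, which is harmless: outside `P k` the selected pair has `‖f n (g i)‖ > k ‖g i‖
    -- ≥ 0`.
    refine ⟨fun l => r l.unpair.1 l.unpair.2 • g l.unpair.2, ?_⟩
    filter_upwards [ae_all_iff.2 fun n => ae_all_iff.2 fun i => hr' n i,
      ae_all_iff.2 fun n => ae_all_iff.2 fun i => cnorm_smul_ae (r n i) (g i),
      ae_all_iff.2 fun n => ae_all_iff.2 fun i => cnorm_smul_ae (r n i) (f n (g i)),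
      ae_all_iff.2 fun i => cnorm_ae_nonneg (μ := μ) (g i)] with ω h1 h2 h3 h4 hω ε hε
    obtain ⟨k, hk⟩ := exists_nat_gt ε⁻¹
    have hωk : ω ∉ P k := fun h => hω (Set.mem_iUnion.2 ⟨k, h⟩)
    rw [hmem] at hωk
    push Not at hωk
    obtain ⟨n, i, hni⟩ := hωk
    have hpos : 0 < cnorm μ (f n (g i)) ω :=
      (mul_nonneg (Nat.cast_nonneg k) (h4 i)).trans_lt hni
    have hkε : 1 ≤ ε * k := by
      rw [inv_eq_one_div, div_lt_iff₀ hε] at hk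
      linarith
    refine ⟨Nat.pair n i, n, ?_, ?_⟩
    · simp only [Nat.unpair_pair]
      rw [h2, h1, abs_of_pos (inv_pos.2 hpos), inv_mul_le_iff₀ hpos]
      nlinarith [h4 i]
    · simp only [Nat.unpair_pair, map_smul]
      rw [h3, h1, abs_of_pos (inv_pos.2 hpos), inv_mul_cancel₀ hpos.ne']

lemma SeqContinuousAE.exists_bound (hH : CondSeparable μ H) {f : H →ₗ[L0 ℝ μ] K}
    (hf : SeqContinuousAE μ f) :
    ∃ q : Ω → ℕ, Measurable q ∧ ∀ x, ∀ᵐ ω ∂μ, cnorm μ (f x) ω ≤ q ω * cnorm μ x ω := by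
  rcases bounded_or_exists_small hH (fun _ => f) (fun _ => hf) with ⟨q, hqm, hq⟩ | h
  · exact ⟨q, hqm, hq 0⟩
  obtain ⟨A, hA, hA0, u, hu⟩ := h
  have hsel : ∀ k : ℕ, ∃ z : H, ∀ᵐ ω ∂μ, ω ∈ A →
      cnorm μ z ω ≤ 1 / ((k : ℝ) + 1) ∧ cnorm μ (f z) ω = 1 := fun k => by
    -- Including `Aᶜ` makes every index admissible off `A`, so the selection is defined on all of
    -- `Ω`.
    set P : ℕ → Set Ω := fun l =>
      Aᶜ ∪ ({ω | cnorm μ (u l) ω ≤ 1 / ((k : ℝ) + 1)} ∩ {ω | cnorm μ (f (u l)) ω = 1})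
    have hP : ∀ l, MeasurableSet (P l) := fun l =>
      hA.compl.union ((measurableSet_le (measurable_cnorm _) measurable_const).inter
        (measurableSet_eq_fun (measurable_cnorm _) measurable_const))
    obtain ⟨τ, hτm, hτ⟩ := exists_measurable_index (μ := μ) hP (by
      filter_upwards [hu] with ω hω
      by_cases hωA : ω ∈ A
      · obtain ⟨l, -, h1, h2⟩ := hω hωA (1 / ((k : ℝ) + 1)) Nat.one_div_pos_of_nat
        exact ⟨l, Or.inr ⟨h1, h2⟩⟩
      · exact ⟨0, Or.inl hωA⟩)
    obtain ⟨z, hz1, hz2⟩ := exists_cnorm_map_ae_eq (K := K) (μ := μ) u τ hτm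
    refine ⟨z, ?_⟩
    have hz3 := hz2 0
    simp only [sub_zero] at hz3
    filter_upwards [hτ, hz1 f, hz3] with ω h1 h2 h3 hωA
    rw [h2, h3]
    exact h1.resolve_left fun h => h hωA
  choose z hz using hsel
  -- cutting off outside `A` makes the sequence converge to `0` everywhere
  have hind : ∀ᵐ ω ∂μ, ind μ A hA ω = A.indicator (fun _ => (1 : ℝ)) ω := AEEqFun.coeFn_mk _ _
  have hlim : CTendsto μ (fun k => ind μ A hA • z k) 0 := by
    filter_upwards [ae_all_iff.2 hz, hind,
      ae_all_iff.2 fun k => cnorm_smul_ae (ind μ A hA) (z k),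
      ae_all_iff.2 fun k => cnorm_ae_nonneg (μ := μ) (z k)] with ω h1 h2 h3 h4
    simp only [sub_zero]
    refine squeeze_zero (fun k => ?_) (fun k => ?_) tendsto_one_div_add_atTop_nhds_zero_nat
    · rw [h3]
      exact mul_nonneg (abs_nonneg _) (h4 k)
    · rw [h3, h2]
      by_cases hω : ω ∈ A
      · simpa [hω] using (h1 k hω).1
      · simpa [hω] using (Nat.one_div_pos_of_nat (α := ℝ) (n := k)).le
  refine absurd (measure_eq_zero_iff_ae_notMem.2 ?_) hA0
  filter_upwards [ae_all_iff.2 hz, hind, hf _ _ hlim,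
    ae_all_iff.2 fun k => cnorm_smul_ae (ind μ A hA) (f (z k))] with ω h1 h2 h3 h4 hω
  simp only [map_zero, sub_zero, map_smul] at h3
  have h5 : (fun k => cnorm μ (ind μ A hA • f (z k)) ω) = fun _ => (1 : ℝ) := by
    funext k
    rw [h4, h2, (h1 k hω).2]
    simp [hω]
  rw [h5] at h3
  exact one_ne_zero (tendsto_nhds_unique tendsto_const_nhds h3)

end Boundedness

/-! ### The gliding hump -/

section GlidingHump

variable {Ω : Type*} [MeasurableSpace Ω] {μ : Measure Ω}
variable {H : Type*} [AddCommGroup H] [Module (L0 ℝ μ) H] [NormedL0Module μ H]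
variable {K : Type*} [AddCommGroup K] [Module (L0 ℝ μ) K] [NormedL0Module μ K]

/-- Adding natural multiples of `v` to `x`. -/
lemma exists_add_nat_smul (f : ℕ → H →ₗ[L0 ℝ μ] K) (x v : H) :
    ∃ c : ℕ → H, (∀ z, ∀ᵐ ω ∂μ, cnorm μ (c z - x) ω = z * cnorm μ v ω) ∧
      (∀ n z, ∀ᵐ ω ∂μ,
        z * cnorm μ (f n v) ω ≤ cnorm μ (f n (c z)) ω + cnorm μ (f n x) ω) ∧ c 0 = x := by
  refine ⟨fun z => x + (AEEqFun.const Ω (z : ℝ) : L0 ℝ μ) • v, fun z => ?_, fun n z => ?_, ?_⟩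
  · simp only [add_sub_cancel_left]
    filter_upwards [cnorm_const_smul_ae (μ := μ) (z : ℝ) v] with ω h
    rw [h, Nat.abs_cast]
  · have h' := cnorm_add_ae_le (μ := μ)
      (f n (x + (AEEqFun.const Ω (z : ℝ) : L0 ℝ μ) • v)) (-(f n x))
    rw [map_add, map_smul, add_neg_cancel_comm, ← map_smul, ← map_add, map_smul] at h'
    filter_upwards [cnorm_const_smul_ae (μ := μ) (z : ℝ) (f n v), h',
      cnorm_neg_ae (μ := μ) (f n x)] with ω h1 h2 h3
    rwa [h1, h3, Nat.abs_cast] at h2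
  · have h0 : (AEEqFun.const Ω ((0 : ℕ) : ℝ) : L0 ℝ μ) = 0 := by
      rw [Nat.cast_zero]
      rfl
    simp only [h0, zero_smul, add_zero]

/-- Take `u l` tiny with `‖f n (u l)‖ = 1`. Either `‖f n x‖ ≥ j` and `x` is kept, or `‖f n x‖ < j`
and `x + 2j • u l` works, since its image has norm at least `2j - j`. The new `D'` records the bound
of the map `f n` used, so that later steps can be scaled against it. -/
lemma exists_hump (f : ℕ → H →ₗ[L0 ℝ μ] K) {C : ℕ → Ω → ℕ} (hC : ∀ n, Measurable (C n))
    {A : Set Ω} (hA : MeasurableSet A) {u : ℕ → H}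
    (hu : ∀ᵐ ω ∂μ, ω ∈ A → ∀ ε > 0, ∃ l n, cnorm μ (u l) ω ≤ ε ∧ cnorm μ (f n (u l)) ω = 1)
    (j : ℕ) (x : H) {D : Ω → ℕ} (hD : Measurable D) :
    ∃ (x' : H) (D' : Ω → ℕ), Measurable D' ∧ (∀ ω, D ω ≤ D' ω) ∧ ∀ᵐ ω ∂μ,
      cnorm μ (x' - x) ω ≤ (1 / 2) ^ j / (1 + (D ω : ℝ)) ∧
      (ω ∈ A → ∃ n, (j : ℝ) ≤ cnorm μ (f n x') ω ∧ C n ω ≤ D' ω) := by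
  choose c hsmul hmap hc0 using fun l => exists_add_nat_smul f x (u l)
  let P : ℕ → ℕ → ℕ → Set Ω := fun l n z =>
    {ω | cnorm μ (c l z - x) ω ≤ (1 / 2) ^ j / (1 + (D ω : ℝ))} ∩
      (Aᶜ ∪ {ω | (j : ℝ) ≤ cnorm μ (f n (c l z)) ω})
  have hP : ∀ l n z, MeasurableSet (P l n z) := fun l n z =>
    (measurableSet_le (measurable_cnorm _)
      (measurable_const.div (measurable_const.add (measurable_from_nat.comp hD)))).inter
      (hA.compl.union (measurableSet_le measurable_const (measurable_cnorm _)))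
  obtain ⟨e, he⟩ := exists_surjective_nat (ℕ × ℕ × ℕ)
  obtain ⟨τ, hτm, hτ⟩ := exists_measurable_index (μ := μ)
    (P := fun m => P (e m).1 (e m).2.1 (e m).2.2) (fun m => hP _ _ _) (by
    suffices h : ∀ᵐ ω ∂μ, ∃ l n z, ω ∈ P l n z by
      filter_upwards [h] with ω hω
      obtain ⟨l, n, z, h⟩ := hω
      obtain ⟨m, hm⟩ := he (l, n, z)
      exact ⟨m, by rwa [hm]⟩
    filter_upwards [hu, ae_all_iff.2 fun l => ae_all_iff.2 fun z => hsmul l z,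
      ae_all_iff.2 fun l => ae_all_iff.2 fun n => ae_all_iff.2 fun z => hmap l n z]
      with ω h1 h2 h3
    have hpos : (0 : ℝ) < (1 / 2) ^ j / (1 + (D ω : ℝ)) := by positivity
    have hzero : ∀ l, cnorm μ (c l 0 - x) ω ≤ (1 / 2) ^ j / (1 + (D ω : ℝ)) := fun l => by
      rw [h2, Nat.cast_zero, zero_mul]
      exact hpos.le
    by_cases hω : ω ∈ A
    -- Dividing by `2j + 1` rather than `2j` keeps the tolerance meaningful at `j = 0`.
    · obtain ⟨l, n, hl, hn⟩ := h1 hω ((1 / 2) ^ j / (1 + (D ω : ℝ)) / (2 * j + 1)) (by positivity)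
      by_cases hx : (j : ℝ) ≤ cnorm μ (f n x) ω
      · exact ⟨l, n, 0, hzero l, Or.inr (by simpa only [Set.mem_ofPred_eq, hc0] using hx)⟩
      · refine ⟨l, n, 2 * j, ?_, Or.inr ?_⟩
        · rw [le_div_iff₀ (by positivity)] at hl
          have h5 := h2 l (2 * j)
          simp only [Set.mem_ofPred_eq]
          rw [h5]
          push_cast
          by_cases hneg : 0 ≤ cnorm μ (u l) ω
          · linarith
          · exact (mul_nonpos_of_nonneg_of_nonpos (by positivity) (not_le.1 hneg).le).trans hpos.le
        · have h5 := h3 l n (2 * j)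
          rw [hn] at h5
          push_cast at h5
          simp only [Set.mem_ofPred_eq]
          linarith
    · exact ⟨0, 0, 0, hzero 0, Or.inl hω⟩)
  obtain ⟨z, hz1, hz2⟩ := exists_cnorm_map_ae_eq (K := K) (μ := μ)
    (fun m => c (e m).1 (e m).2.2) τ hτm
  have hCτ : Measurable fun ω => C (e (τ ω)).2.1 ω :=
    (measurable_from_prod_countable_left (f := fun p : Ω × ℕ => C (e p.2).2.1 p.1)
      fun m => hC (e m).2.1).comp (measurable_id.prodMk hτm)
  refine ⟨z, fun ω => D ω + C (e (τ ω)).2.1 ω, hD.add hCτ,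
    fun ω => Nat.le_add_right _ _, ?_⟩
  filter_upwards [hτ, ae_all_iff.2 fun n => hz1 (f n), hz2 x] with ω h1 h2 h3
  refine ⟨by rw [h3]; exact h1.1, fun hω => ⟨(e (τ ω)).2.1, ?_, Nat.le_add_left _ _⟩⟩
  rw [h2]
  exact h1.2.resolve_left fun h => h hω

/-- The steps telescope as a geometric series. Since `D` is monotone, every step after `j` is at
least as small as with denominator `1 + D j`. -/
lemma le_div_of_geometric_steps {a : ℕ → ℕ → ℝ} {D : ℕ → ℕ} (hD : Monotone D)
    (h0 : ∀ j, a j j ≤ 0) (htri : ∀ j l, a j (l + 1) ≤ a j l + a l (l + 1))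
    (hstep : ∀ l, a l (l + 1) ≤ (1 / 2) ^ l / (1 + (D l : ℝ))) {j l : ℕ} (hjl : j ≤ l) :
    a j l ≤ 2 * (1 / 2) ^ j / (1 + (D j : ℝ)) := by
  have key : a j l ≤ (2 * (1 / 2) ^ j - 2 * (1 / 2) ^ l) / (1 + (D j : ℝ)) := by
    induction l, hjl using Nat.le_induction with
    | base => simpa using h0 j
    | succ l hl ih =>
      have hDl : (D j : ℝ) ≤ D l := Nat.cast_le.2 (hD hl)
      have h1 : (1 / 2 : ℝ) ^ l / (1 + (D l : ℝ)) ≤ (1 / 2) ^ l / (1 + (D j : ℝ)) := by gcongr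
      calc a j (l + 1) ≤ a j l + a l (l + 1) := htri j l
        _ ≤ (2 * (1 / 2) ^ j - 2 * (1 / 2) ^ l) / (1 + (D j : ℝ)) +
            (1 / 2) ^ l / (1 + (D j : ℝ)) := add_le_add ih ((hstep l).trans h1)
        _ = _ := by rw [← add_div, pow_succ]; ring
  refine key.trans ?_
  gcongr
  linarith [pow_pos (one_half_pos (α := ℝ)) l]

/-- The factor `4` accounts for two distances of at most `2 * (1 / 2) ^ n` in the Cauchy estimate.
-/
lemma exists_nat_geometric_lt {r : L0 ℝ μ} (hr : r ∈ L0PosRat μ) :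
    ∃ n : L0 ℕ μ, ∀ᵐ ω ∂μ, 4 * (1 / 2 : ℝ) ^ (n ω) < r ω := by
  obtain ⟨s, hs, rfl⟩ := hr
  have hpos : ∀ᵐ ω ∂μ, 0 < ratToReal s ω := by
    filter_upwards [hs, AEEqFun.coeFn_comp _ Rat.continuous_coe_real s,
      AEEqFun.coeFn_zero (μ := μ) (β := ℚ)] with ω h1 h2 h3
    rw [h3] at h1
    rw [ratToReal, h2]
    exact Rat.cast_pos.2 h1
  obtain ⟨τ, hτm, hτ⟩ := exists_measurable_index (μ := μ)
    (P := fun k => {ω | 4 * (1 / 2 : ℝ) ^ k < ratToReal s ω})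
    (fun k => measurableSet_lt measurable_const (ratToReal s).stronglyMeasurable.measurable) (by
    filter_upwards [hpos] with ω hω
    obtain ⟨k, hk⟩ := exists_pow_lt_of_lt_one (show 0 < ratToReal s ω / 4 by positivity)
      (show (1 / 2 : ℝ) < 1 by norm_num)
    refine ⟨k, ?_⟩
    linarith)
  refine ⟨AEEqFun.mk τ hτm.aestronglyMeasurable, ?_⟩
  filter_upwards [hτ, AEEqFun.coeFn_mk τ (hτm.aestronglyMeasurable (μ := μ))] with ω h1 h2
  rw [h2]
  exact h1

lemma isCondCauchy_of_geometric {x : ℕ → H} (h : ∀ᵐ ω ∂μ, ∀ j l, j ≤ l →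
    cnorm μ (x l - x j) ω ≤ 2 * (1 / 2) ^ j) : IsCondCauchy μ x := by
  intro r hr
  obtain ⟨n, hn⟩ := exists_nat_geometric_lt hr
  refine ⟨n, fun m p hm hp => ?_⟩
  filter_upwards [h, hn, AEEqFun.coeFn_le.2 hm, AEEqFun.coeFn_le.2 hp,
    cnorm_seqAt_sub_seqAt_ae x m p,
    ae_all_iff.2 fun i => ae_all_iff.2 fun k => ae_all_iff.2 fun l =>
      cnorm_sub_ae_le (μ := μ) (x i) (x k) (x l),
    ae_all_iff.2 fun i => ae_all_iff.2 fun k => cnorm_sub_comm_ae (μ := μ) (x i) (x k)]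
    with ω h1 h2 h3 h4 h5 h6 h7
  rw [h5]
  have h8 := h6 (m ω) (n ω) (p ω)
  rw [h7 (n ω)] at h8
  linarith [h1 _ _ h3, h1 _ _ h4]

/-- The gliding hump argument. -/
lemma measure_eq_zero_of_small (hH : CondComplete μ H) (f : ℕ → H →ₗ[L0 ℝ μ] K)
    {C : ℕ → Ω → ℕ} (hCm : ∀ n, Measurable (C n))
    (hC : ∀ n x, ∀ᵐ ω ∂μ, cnorm μ (f n x) ω ≤ C n ω * cnorm μ x ω)
    (hbdd : ∀ x : H, ∃ r : L0 ℝ μ, ∀ n, cnorm μ (f n x) ≤ r)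
    {A : Set Ω} (hA : MeasurableSet A) {u : ℕ → H}
    (hu : ∀ᵐ ω ∂μ, ω ∈ A → ∀ ε > 0, ∃ l n, cnorm μ (u l) ω ≤ ε ∧ cnorm μ (f n (u l)) ω = 1) :
    μ A = 0 := by
  have hstep : ∀ (j : ℕ) (p : H × {D : Ω → ℕ // Measurable D}),
      ∃ p' : H × {D : Ω → ℕ // Measurable D}, (∀ ω, p.2.1 ω ≤ p'.2.1 ω) ∧ ∀ᵐ ω ∂μ,
      cnorm μ (p'.1 - p.1) ω ≤ (1 / 2) ^ j / (1 + (p.2.1 ω : ℝ)) ∧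
      (ω ∈ A → ∃ n, (j : ℝ) ≤ cnorm μ (f n p'.1) ω ∧ C n ω ≤ p'.2.1 ω) := fun j p => by
    obtain ⟨x', D', hD', h⟩ := exists_hump f hCm hA hu j p.1 p.2.2
    exact ⟨(x', ⟨D', hD'⟩), h⟩
  choose next hnext using hstep
  let p : ℕ → H × {D : Ω → ℕ // Measurable D} := fun j =>
    Nat.rec (0, ⟨fun _ => 0, measurable_const⟩) next j
  have hp : ∀ j, p (j + 1) = next j (p j) := fun _ => rfl
  let x : ℕ → H := fun j => (p j).1
  let D : ℕ → Ω → ℕ := fun j => (p j).2.1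
  have hDmono : ∀ ω, Monotone fun j => D j ω := fun ω =>
    monotone_nat_of_le_succ fun j => (hnext j (p j)).1 ω
  have hxD : ∀ j, ∀ᵐ ω ∂μ, cnorm μ (x (j + 1) - x j) ω ≤ (1 / 2) ^ j / (1 + (D j ω : ℝ)) ∧
      (ω ∈ A → ∃ n, (j : ℝ) ≤ cnorm μ (f n (x (j + 1))) ω ∧ C n ω ≤ D (j + 1) ω) := fun j =>
    (hnext j (p j)).2
  have hdist : ∀ᵐ ω ∂μ, ∀ j l, j ≤ l →
      cnorm μ (x l - x j) ω ≤ 2 * (1 / 2) ^ j / (1 + (D j ω : ℝ)) := by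
    filter_upwards [ae_all_iff.2 hxD,
      ae_all_iff.2 fun i => ae_all_iff.2 fun k => ae_all_iff.2 fun l =>
        cnorm_sub_ae_le (μ := μ) (x i) (x k) (x l),
      cnorm_const_smul_ae (μ := μ) 0 (0 : H)] with ω h1 h2 h3 j l hjl
    refine le_div_of_geometric_steps (a := fun j l => cnorm μ (x l - x j) ω) (hDmono ω)
      (fun j => ?_) (fun j l => ?_) (fun l => (h1 l).1) hjl
    · rw [smul_zero, abs_zero, zero_mul] at h3
      simp only [sub_self, h3, le_refl]
    · exact (h2 (l + 1) l j).trans_eq (add_comm _ _)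
  obtain ⟨y, hy⟩ := hH x (isCondCauchy_of_geometric (by
    filter_upwards [hdist] with ω h j l hjl
    exact (h j l hjl).trans (div_le_self (by positivity) (by simp))))
  obtain ⟨r, hr⟩ := hbdd y
  refine measure_eq_zero_iff_ae_notMem.2 ?_
  filter_upwards [ae_all_iff.2 hxD, hdist, hy, ae_all_iff.2 fun n => AEEqFun.coeFn_le.2 (hr n),
    ae_all_iff.2 fun j => ae_all_iff.2 fun l => cnorm_sub_ae_le (μ := μ) (x j) (x l) y,
    ae_all_iff.2 fun j => ae_all_iff.2 fun l => cnorm_sub_comm_ae (μ := μ) (x j) (x l),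
    ae_all_iff.2 fun n => ae_all_iff.2 fun j => hC n (x j - y),
    ae_all_iff.2 fun n => ae_all_iff.2 fun j => abs_cnorm_sub_cnorm_ae_le (μ := μ) (f n (x j)) (f n y)]
    with ω h1 h2 h3 h4 h5 h6 h7 h8 hω
  -- The extra `1` absorbs the loss in passing from `x (j + 1)` to the limit `y`.
  obtain ⟨j, hj⟩ := exists_nat_gt (r ω + 1)
  obtain ⟨n, hn, hCn⟩ := (h1 j).2 hω
  have h9 : cnorm μ (x (j + 1) - y) ω ≤ 2 * (1 / 2) ^ (j + 1) / (1 + (D (j + 1) ω : ℝ)) := by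
    have hlim : Tendsto (fun l => 2 * (1 / 2) ^ (j + 1) / (1 + (D (j + 1) ω : ℝ)) +
        cnorm μ (x l - y) ω) atTop (𝓝 (2 * (1 / 2) ^ (j + 1) / (1 + (D (j + 1) ω : ℝ)) + 0)) :=
      tendsto_const_nhds.add h3
    rw [add_zero] at hlim
    refine ge_of_tendsto hlim (eventually_atTop.2 ⟨j + 1, fun l hl => ?_⟩)
    refine (h5 (j + 1) l).trans (add_le_add ?_ le_rfl)
    exact (h6 _ _).trans_le (h2 _ _ hl)
  have h10 : (C n ω : ℝ) * cnorm μ (x (j + 1) - y) ω ≤ 1 := by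
    have hCn' : (C n ω : ℝ) ≤ D (j + 1) ω := Nat.cast_le.2 hCn
    have hpow : (1 / 2 : ℝ) ^ (j + 1) ≤ 1 / 2 :=
      pow_le_of_le_one (by norm_num) (by norm_num) (by simp)
    -- `D (j + 1)` dominates `C n` for the very `n` chosen at step `j`, so the denominator cancels
    -- the growth of `f n`.
    calc (C n ω : ℝ) * cnorm μ (x (j + 1) - y) ω
        ≤ C n ω * (2 * (1 / 2) ^ (j + 1) / (1 + (D (j + 1) ω : ℝ))) := by gcongr
      _ ≤ (1 + (D (j + 1) ω : ℝ)) * (2 * (1 / 2) ^ (j + 1) / (1 + (D (j + 1) ω : ℝ))) := by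
        gcongr
        linarith
      _ = 2 * (1 / 2) ^ (j + 1) := by field_simp
      _ ≤ 1 := by linarith
  have h11 := h7 n (j + 1)
  rw [map_sub] at h11
  have h12 := (abs_le.1 (h8 n (j + 1))).2
  have h13 : cnorm μ (f n y) ω ≤ r ω := h4 n
  linarith

/-- The bound `q` may vanish; adding `1` makes it strictly positive. -/
lemma exists_mem_L0PosRat (q : Ω → ℕ) (hq : Measurable q) :
    ∃ r ∈ L0PosRat μ, ∀ᵐ ω ∂μ, r ω = q ω + 1 := by
  have hm : Measurable fun ω => (q ω : ℚ) + 1 :=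
    (measurable_from_nat (f := fun k : ℕ => (k : ℚ) + 1)).comp hq
  have h := AEEqFun.coeFn_mk (fun ω => (q ω : ℚ) + 1) (hm.aestronglyMeasurable (μ := μ))
  refine ⟨ratToReal (AEEqFun.mk _ hm.aestronglyMeasurable), ⟨_, ?_, rfl⟩, ?_⟩
  · filter_upwards [h, AEEqFun.coeFn_zero (μ := μ) (β := ℚ)] with ω h1 h2
    rw [h1, h2]
    exact Nat.cast_add_one_pos (q ω)
  · filter_upwards [h, AEEqFun.coeFn_comp _ Rat.continuous_coe_real
      (AEEqFun.mk (μ := μ) _ hm.aestronglyMeasurable)] with ω h1 h2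
    rw [ratToReal, h2, Function.comp_apply, h1]
    push_cast
    rfl

end GlidingHump

end CondAnalysis

theorem mainTheorem11 {Ω : Type*} [MeasurableSpace Ω] (μ : Measure Ω) [SigmaFinite μ]
    {H K : Type*}
    [AddCommGroup H] [Module (CondAnalysis.L0 ℝ μ) H] [CondAnalysis.NormedL0Module μ H]
    [AddCommGroup K] [Module (CondAnalysis.L0 ℝ μ) K] [CondAnalysis.NormedL0Module μ K]
    (hHs : CondAnalysis.CondSeparable μ H) (hHc : CondAnalysis.CondComplete μ H)
    (hKs : CondAnalysis.CondSeparable μ K) (hKc : CondAnalysis.CondComplete μ K)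
    (f : ℕ → H →ₗ[CondAnalysis.L0 ℝ μ] K)
    (hf : ∀ n, CondAnalysis.SeqContinuousAE μ (f n))
    (hbdd : ∀ x : H, ∃ r ∈ CondAnalysis.L0PosRat μ, ∀ n, CondAnalysis.cnorm μ (f n x) ≤ r) :
    ∃ q ∈ CondAnalysis.L0PosRat μ, ∀ (n : ℕ) (x : H),
      CondAnalysis.cnorm μ (f n x) ≤ q * CondAnalysis.cnorm μ x := by
  rcases CondAnalysis.bounded_or_exists_small hHs f hf with ⟨q, hqm, hq⟩ | ⟨A, hA, hA0, u, hu⟩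
  · obtain ⟨r, hr, hrq⟩ := CondAnalysis.exists_mem_L0PosRat (μ := μ) q hqm
    refine ⟨r, hr, fun n x => AEEqFun.coeFn_le.1 ?_⟩
    filter_upwards [hq n x, hrq, AEEqFun.coeFn_mul r (CondAnalysis.cnorm μ x),
      CondAnalysis.cnorm_ae_nonneg (μ := μ) x] with ω h1 h2 h3 h4
    refine h1.trans (le_of_le_of_eq ?_ h3.symm)
    rw [Pi.mul_apply, h2]
    exact mul_le_mul_of_nonneg_right (by linarith) h4
  · choose C hCm hC using fun n => (hf n).exists_bound hHs
    exact absurd (CondAnalysis.measure_eq_zero_of_small hHc f hCm hC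
      (fun x => (hbdd x).imp fun r hr => hr.2) hA hu) hA0
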